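/- A computable linear order is a pair $\mathcal L=(L,\prec_{\mathcal L})$ where $L\subseteq\mathbb N$ is a non-empty computable set and $\prec_{\mathcal L}$ is a computable strict linear order on $L$; it is a computable copy of $\omega$ if it is isomorphic to $(\mathbb N,<)$. Write $X\subseteq^* Y$ if $X\setminus Y$ is finite. An infinite set $C\subseteq\mathbb N$ is cohesive if for every c.e. set $W\subseteq\mathbb N$, either $C\subseteq^* W$ or $C\subseteq^*\mathbb N\setminus W$. The cohesive power $\Pi_C\mathcal L$ is the linear order whose elements are the classes $[\varphi]$ of the partial computable functions $\varphi$ from $\mathbb N$ to $L$ with $C\subseteq^*\operatorname{dom}(\varphi)$, where $[\varphi]=[\psi]$ iff $C\subseteq^*\{x:\varphi(x){\downarrow}=\psi(x){\downarrow}\}$, ordered by $[\varphi]\prec[\psi]$ iff $C\subseteq^*\{x:\varphi(x){\downarrow},\ \psi(x){\downarrow},\ \varphi(x)\prec_{\mathcal L}\psi(x)\}$. Let $\omega+\zeta\eta$ denote a copy of $(\mathbb N,<)$ followed by a copy of $\mathbb Z$ for each rational, the copies of $\mathbb Z$ being ordered as the rationals. **Theorem.** Let $C$ be any cohesive set. Then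 there is a computable copy $\mathcal L$ of $\omega$, with domain $\mathbb N$, for which $\Pi_C\mathcal L$ is not elementarily equivalent, in the first-order language of linear orders (one binary relation symbol $\prec$), and hence not isomorphic, to $\omega+\zeta\eta$. Moreover, the element $[\mathrm{id}]$ of $\Pi_C\mathcal L$ represented by the identity function $\mathrm{id}\colon\mathbb N\to\mathbb N$ has no immediate successor in $\Pi_C\mathcal L$: there is no $b\in\Pi_C\mathcal L$ such that $[\mathrm{id}]\prec b$ and no element lies strictly between $[\mathrm{id}]$ and $b$. -/

import Mathlib

namespace CohPow

/-- Inclusion up to finitely many exceptions, `X ⊆* Y`. -/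
def AlmostSubset (X Y : Set ℕ) : Prop := (X \ Y).Finite

/-- An infinite set `C ⊆ ℕ` is cohesive if every c.e. set `W` satisfies
`C ⊆* W` or `C ⊆* Wᶜ`. -/
def IsCohesive (C : Set ℕ) : Prop :=
  C.Infinite ∧ ∀ W : Set ℕ, REPred (fun n => n ∈ W) → AlmostSubset C W ∨ AlmostSubset C Wᶜ

/-- A computable (strict) linear order: a non-empty computable domain `A ⊆ ℕ` with a computable
binary relation on `A` that is irreflexive, transitive and total. -/
structure ComputableLinearOrder where
  domain : Set ℕ
  lt : ℕ → ℕ → Prop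
  nonempty : domain.Nonempty
  computable_domain : ComputablePred (fun n : ℕ => n ∈ domain)
  computable_lt : ComputablePred (fun p : ℕ × ℕ => lt p.1 p.2)
  mem_of_lt : ∀ a b, lt a b → a ∈ domain ∧ b ∈ domain
  irrefl : ∀ a, ¬ lt a a
  trans : ∀ a b c, lt a b → lt b c → lt a c
  total : ∀ a ∈ domain, ∀ b ∈ domain, lt a b ∨ a = b ∨ lt b a

/-- `L` is a computable copy of `ω`: it is isomorphic to `(ℕ, <)`. -/
def ComputableLinearOrder.IsCopyOfOmega (L : ComputableLinearOrder) : Prop :=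
  Nonempty ((fun a b : L.domain => L.lt a b) ≃r ((· < ·) : ℕ → ℕ → Prop))

/-- `φ` is a partial computable function from `ℕ` to the domain of `L` with `C ⊆* dom φ`. -/
def IsRepresentative (L : ComputableLinearOrder) (C : Set ℕ) (φ : ℕ →. ℕ) : Prop :=
  Partrec φ ∧ (∀ x, ∀ a ∈ φ x, a ∈ L.domain) ∧ AlmostSubset C φ.Dom

/-- The set `D` of representatives of elements of the cohesive power. -/
def Representative (L : ComputableLinearOrder) (C : Set ℕ) : Type :=
  {φ : ℕ →. ℕ // IsRepresentative L C φ}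

/-- `φ =_C ψ` means `C ⊆* {x : φ(x)↓ = ψ(x)↓}`. -/
def Representative.Equiv {L : ComputableLinearOrder} {C : Set ℕ}
    (φ ψ : Representative L C) : Prop :=
  AlmostSubset C {x | ∃ a, a ∈ φ.1 x ∧ a ∈ ψ.1 x}

/-- `C ⊆* {x : φ(x)↓, ψ(x)↓ and φ(x) ≺ ψ(x)}`. -/
def Representative.Lt {L : ComputableLinearOrder} {C : Set ℕ}
    (φ ψ : Representative L C) : Prop :=
  AlmostSubset C {x | ∃ a b, a ∈ φ.1 x ∧ b ∈ ψ.1 x ∧ L.lt a b}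

theorem AlmostSubset.mono {C X Y : Set ℕ} (h : AlmostSubset C X) (hXY : X ⊆ Y) :
    AlmostSubset C Y :=
  Set.Finite.subset h (Set.sdiff_subset_sdiff_right hXY)

theorem AlmostSubset.inter {C X Y : Set ℕ} (hX : AlmostSubset C X) (hY : AlmostSubset C Y) :
    AlmostSubset C (X ∩ Y) := by
  unfold AlmostSubset at *
  rw [Set.sdiff_inter]
  exact hX.union hY

theorem Representative.equiv_refl {L : ComputableLinearOrder} {C : Set ℕ}
    (φ : Representative L C) : φ.Equiv φ :=
  φ.2.2.2.mono fun x hx => ⟨(φ.1 x).get hx, Part.get_mem hx, Part.get_mem hx⟩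

theorem Representative.equiv_symm {L : ComputableLinearOrder} {C : Set ℕ}
    {φ ψ : Representative L C} (h : φ.Equiv ψ) : ψ.Equiv φ :=
  AlmostSubset.mono h fun _ ⟨a, h1, h2⟩ => ⟨a, h2, h1⟩

theorem Representative.equiv_trans {L : ComputableLinearOrder} {C : Set ℕ}
    {φ ψ θ : Representative L C} (h : φ.Equiv ψ) (h' : ψ.Equiv θ) : φ.Equiv θ :=
  (AlmostSubset.inter h h').mono fun _ ⟨⟨a, h1, h2⟩, ⟨_, h3, h4⟩⟩ =>
    ⟨a, h1, Part.mem_unique h3 h2 ▸ h4⟩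

theorem Representative.lt_of_equiv {L : ComputableLinearOrder} {C : Set ℕ}
    {φ ψ φ' ψ' : Representative L C} (h : φ.Equiv φ') (h' : ψ.Equiv ψ') (hlt : φ.Lt ψ) :
    φ'.Lt ψ' :=
  ((AlmostSubset.inter h h').inter hlt).mono
    fun _ ⟨⟨⟨c, h1, h2⟩, ⟨d, h3, h4⟩⟩, ⟨_, _, h5, h6, h7⟩⟩ =>
      ⟨c, d, h2, h4, Part.mem_unique h5 h1 ▸ Part.mem_unique h6 h3 ▸ h7⟩

/-- The equivalence relation `=_C`. -/
instance Representative.setoid (L : ComputableLinearOrder) (C : Set ℕ) :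
    Setoid (Representative L C) where
  r := Representative.Equiv
  iseqv := ⟨Representative.equiv_refl, Representative.equiv_symm, Representative.equiv_trans⟩

/-- The domain of the cohesive power `Π_C L`: representatives modulo `=_C`. -/
def CohesivePower (L : ComputableLinearOrder) (C : Set ℕ) : Type :=
  Quotient (Representative.setoid L C)

/-- The element `[φ]` of `Π_C L`. -/
def CohesivePower.mk {L : ComputableLinearOrder} {C : Set ℕ} (φ : ℕ →. ℕ)
    (hφ : IsRepresentative L C φ) : CohesivePower L C :=
  Quotient.mk (Representative.setoid L C) ⟨φ, hφ⟩

/-- The order relation of `Π_C L`. -/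
instance CohesivePower.instLT (L : ComputableLinearOrder) (C : Set ℕ) :
    LT (CohesivePower L C) where
  lt := Quotient.lift₂ Representative.Lt fun _ _ _ _ h h' =>
    propext ⟨Representative.lt_of_equiv h h',
      Representative.lt_of_equiv (Representative.equiv_symm h) (Representative.equiv_symm h')⟩

/-- The only symbol of the language of linear orders: a binary relation symbol `≺`. -/
inductive LinOrdRel : ℕ → Type
  | lt : LinOrdRel 2

/-- The first-order language of (strict) linear orders. -/
def linOrd : FirstOrder.Language := ⟨fun _ => Empty, LinOrdRel⟩

/-- Every type with a relation `<` is a structure for the language of linear orders. -/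
instance linOrdStructure (M : Type) [LT M] : linOrd.Structure M where
  funMap := fun f => Empty.elim f
  RelMap := fun {_} R => match R with
    | LinOrdRel.lt => fun v => v 0 < v 1

/-- The linear order `ω + ζη`: a copy of `ℕ` followed by `ℚ` many copies of `ℤ`. -/
abbrev OmegaPlusZetaEta : Type := ℕ ⊕ₗ (ℚ ×ₗ ℤ)

end CohPow

/-! Cohesiveness is used only to place `C`, up to finitely many points, in one parity class `d`.
Each number of that class is the first element of a block, and numbers of the other parity serve as
separators. If the code `e < m` halts on `n = 2m + d`, a separator recording `m`, `e` and the
halting stage enters block `m`. It exceeds the value `v` numerically, and separators in a block are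
ordered decreasingly, so `n ≺ v` puts it strictly between `n` and `v` (`exists_mem_separator`).

Each `e < m` asks for at most one separator, so the blocks are finite and the order has type `ω`
(`finite_block_eq`). A fixed code satisfies `e < m` at almost all points of `C`, so no class is an
immediate successor of `[id]` (`not_mk_id_covBy`). In `ω + ζη` every element has one, which is a
first-order property. -/

namespace CohPow

open Nat.Partrec (Code)
open Nat.Partrec.Code (evaln eval)

/-! ### Halting stages -/

/-- The code with number `e` halts on input `n` within `s` steps, with value below `s`. -/
def HaltsWithin (e n s : ℕ) : Prop :=
  -- The default `s` makes an unfinished computation fail the test.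
  (evaln s (Denumerable.ofNat Code e) n).getD s < s

instance (e n s : ℕ) : Decidable (HaltsWithin e n s) :=
  inferInstanceAs (Decidable (_ < _))

theorem haltsWithin_iff {e n s : ℕ} :
    HaltsWithin e n s ↔ ∃ v ∈ evaln s (Denumerable.ofNat Code e) n, v < s := by
  unfold HaltsWithin
  cases evaln s (Denumerable.ofNat Code e) n <;> simp

theorem HaltsWithin.mono {e n s t : ℕ} (h : HaltsWithin e n s) (hst : s ≤ t) :
    HaltsWithin e n t := by
  rw [haltsWithin_iff] at h ⊢
  obtain ⟨v, hv, hs⟩ := h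
  exact ⟨v, Nat.Partrec.Code.evaln_mono hst hv, hs.trans_le hst⟩

/-- Stage `s` is the last one before the computation of the code `e` on `n` is seen to halt. -/
def HaltsAfter (e n s : ℕ) : Prop :=
  HaltsWithin e n (s + 1) ∧ ¬ HaltsWithin e n s

instance (e n s : ℕ) : Decidable (HaltsAfter e n s) :=
  inferInstanceAs (Decidable (_ ∧ _))

theorem HaltsAfter.unique {e n s t : ℕ} (hs : HaltsAfter e n s) (ht : HaltsAfter e n t) :
    s = t := by
  rcases lt_trichotomy s t with h | h | h
  · exact absurd (hs.1.mono h) ht.2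
  · exact h
  · exact absurd (ht.1.mono h) hs.2

theorem exists_haltsAfter {e n v : ℕ} (h : v ∈ eval (Denumerable.ofNat Code e) n) :
    ∃ s, HaltsAfter e n s := by
  classical
  obtain ⟨k, hk⟩ := Nat.Partrec.Code.evaln_complete.1 h
  have hex : ∃ s, HaltsWithin e n s :=
    ⟨max k (v + 1), haltsWithin_iff.2
      ⟨v, Nat.Partrec.Code.evaln_mono (le_max_left _ _) hk, by omega⟩⟩
  obtain ⟨s, hs⟩ : ∃ s, Nat.find hex = s + 1 := by
    refine Nat.exists_eq_succ_of_ne_zero fun h0 => ?_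
    have := Nat.find_spec hex
    rw [h0] at this
    exact Nat.not_lt_zero _ this
  exact ⟨s, hs ▸ Nat.find_spec hex, Nat.find_min hex (by omega)⟩

theorem HaltsAfter.value_le {e n s v : ℕ} (h : HaltsAfter e n s)
    (hv : v ∈ eval (Denumerable.ofNat Code e) n) : v ≤ s := by
  obtain ⟨w, hw, hws⟩ := haltsWithin_iff.1 h.1
  rw [Part.mem_unique hv (Nat.Partrec.Code.evaln_sound hw)]
  omega

theorem primrecPred_haltsWithin {α : Type*} [Primcodable α] {e n s : α → ℕ} (he : Primrec e)
    (hn : Primrec n) (hs : Primrec s) : PrimrecPred fun a => HaltsWithin (e a) (n a) (s a) :=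
  Primrec.nat_lt.comp
    (Primrec.option_getD.comp
      (Nat.Partrec.Code.primrec_evaln.comp
        ((hs.pair ((Primrec.ofNat Code).comp he)).pair hn)) hs) hs

theorem primrecPred_haltsAfter {α : Type*} [Primcodable α] {e n s : α → ℕ} (he : Primrec e)
    (hn : Primrec n) (hs : Primrec s) : PrimrecPred fun a => HaltsAfter (e a) (n a) (s a) :=
  (primrecPred_haltsWithin he hn (Primrec.succ.comp hs)).and
    (primrecPred_haltsWithin he hn hs).not

/-! ### The block order and its computability -/

/-- The number `⟨⟨m, e⟩, s⟩` codes a request to separate the main element `2m + d` of block `m`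
from the value of the code `e < m` at it: `s` is the stage of the halting of this computation. -/
def IsRequest (d t : ℕ) : Prop :=
  t.unpair.1.unpair.2 < t.unpair.1.unpair.1 ∧
    HaltsAfter t.unpair.1.unpair.2 (2 * t.unpair.1.unpair.1 + d) t.unpair.2

instance (d t : ℕ) : Decidable (IsRequest d t) :=
  inferInstanceAs (Decidable (_ ∧ _))

/-- The block of a number: the numbers `2m + d` are the main elements of the blocks `m`, and
the numbers of the other parity are put in the blocks that the requests they code ask for. -/
def block (d x : ℕ) : ℕ :=
  if x % 2 = d then x / 2
  else if IsRequest d (x / 2) then (x / 2).unpair.1.unpair.1 else x / 2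

/-- Numbers are ordered by block; in each block the main element comes first, followed by the
other elements in decreasing order. -/
def blockLT (d a b : ℕ) : Prop :=
  block d a < block d b ∨ block d a = block d b ∧ b % 2 ≠ d ∧ (a % 2 = d ∨ b < a)

theorem primrecPred_isRequest (d : ℕ) : PrimrecPred (IsRequest d) := by
  have hu : Primrec fun t : ℕ => t.unpair.1 := Primrec.fst.comp Primrec.unpair
  have h1 : Primrec fun t : ℕ => t.unpair.1.unpair.1 := hu.comp hu
  have h2 : Primrec fun t : ℕ => t.unpair.1.unpair.2 :=
    (Primrec.snd.comp Primrec.unpair).comp hu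
  exact (Primrec.nat_lt.comp h2 h1).and
    (primrecPred_haltsAfter h2
      (Primrec.nat_add.comp (Primrec.nat_mul.comp (Primrec.const 2) h1) (Primrec.const d))
      (Primrec.snd.comp Primrec.unpair))

theorem primrecPred_mod_two (d : ℕ) : PrimrecPred fun x : ℕ => x % 2 = d :=
  Primrec.eq.comp (Primrec.nat_mod.comp Primrec.id (Primrec.const 2)) (Primrec.const d)

theorem primrec_block (d : ℕ) : Primrec (block d) := by
  have hh : Primrec fun x : ℕ => x / 2 := Primrec.nat_div.comp Primrec.id (Primrec.const 2)
  have hu : Primrec fun t : ℕ => t.unpair.1 := Primrec.fst.comp Primrec.unpair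
  exact Primrec.ite (primrecPred_mod_two d) hh
    (Primrec.ite ((primrecPred_isRequest d).comp hh) ((hu.comp hu).comp hh) hh)

theorem PrimrecPred.computablePred {α : Type*} [Primcodable α] {p : α → Prop}
    (h : PrimrecPred p) : ComputablePred p := by
  obtain ⟨i, hp⟩ := h
  exact ⟨i, hp.to_comp⟩

theorem computablePred_blockLT (d : ℕ) :
    ComputablePred fun p : ℕ × ℕ => blockLT d p.1 p.2 := by
  have ha : Primrec fun p : ℕ × ℕ => block d p.1 := (primrec_block d).comp Primrec.fst
  have hb : Primrec fun p : ℕ × ℕ => block d p.2 := (primrec_block d).comp Primrec.snd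
  exact PrimrecPred.computablePred <| (Primrec.nat_lt.comp ha hb).or <|
    (Primrec.eq.comp ha hb).and <| ((primrecPred_mod_two d).comp Primrec.snd).not.and <|
      ((primrecPred_mod_two d).comp Primrec.fst).or (Primrec.nat_lt.comp Primrec.snd Primrec.fst)

theorem blockLT_total (d a b : ℕ) : blockLT d a b ∨ a = b ∨ blockLT d b a := by
  rcases lt_trichotomy (block d a) (block d b) with h | h | h
  · exact .inl (.inl h)
  · by_cases ha : a % 2 = d
    · by_cases hb : b % 2 = d
      · have : a / 2 = b / 2 := by simpa [block, ha, hb] using h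
        exact .inr (.inl (by omega))
      · exact .inl (.inr ⟨h, hb, .inl ha⟩)
    · by_cases hb : b % 2 = d
      · exact .inr (.inr (.inr ⟨h.symm, ha, .inl hb⟩))
      · rcases lt_trichotomy a b with hab | hab | hab
        · exact .inr (.inr (.inr ⟨h.symm, ha, .inr hab⟩))
        · exact .inr (.inl hab)
        · exact .inl (.inr ⟨h, hb, .inr hab⟩)
  · exact .inr (.inr (.inl h))

/-- The computable linear order on `ℕ` given by `blockLT d`. -/
def blockOrder (d : ℕ) : ComputableLinearOrder where
  domain := Set.univ
  lt := blockLT d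
  nonempty := Set.univ_nonempty
  computable_domain := PrimrecPred.computablePred ⟨fun _ => .isTrue trivial, Primrec.const true⟩
  computable_lt := computablePred_blockLT d
  mem_of_lt _ _ _ := ⟨trivial, trivial⟩
  irrefl a h := by unfold blockLT at h; omega
  trans a b c h h' := by unfold blockLT at *; omega
  total a _ b _ := blockLT_total d a b

/-! ### Order type `ω` -/

/-- Besides the numbers with half `m`, a block receives only requests from codes `e < m`, and the
halting stage of each is unique. -/
theorem finite_block_eq (d m : ℕ) : {x | block d x = m}.Finite := by
  have hsub : ∀ e, {s | HaltsAfter e (2 * m + d) s}.Finite := fun e =>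
    Set.Subsingleton.finite fun _ hs _ ht => hs.unique ht
  have hfin : ({x | x / 2 = m} ∪ ⋃ e ∈ Set.Iio m,
      (fun q : ℕ × ℕ => 2 * Nat.pair (Nat.pair m e) q.1 + q.2) ''
        ({s | HaltsAfter e (2 * m + d) s} ×ˢ Set.Iio 2)).Finite := by
    refine .union ((Set.finite_Iio (2 * m + 2)).subset fun x hx => ?_)
      ((Set.finite_Iio m).biUnion fun e _ => ((hsub e).prod (Set.finite_Iio 2)).image _)
    simp only [Set.mem_ofPred_eq, Set.mem_Iio] at hx ⊢
    omega
  refine hfin.subset fun x hx => ?_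
  simp only [Set.mem_ofPred_eq, block] at hx
  split_ifs at hx with h1 h2
  · exact .inl hx
  · refine .inr (Set.mem_biUnion (x := (x / 2).unpair.1.unpair.2) (hx ▸ h2.1)
      ⟨((x / 2).unpair.2, x % 2), ⟨hx ▸ h2.2, Nat.mod_lt _ two_pos⟩, ?_⟩)
    subst hx
    simp only [Nat.pair_unpair]
    omega
  · exact .inl hx

theorem finite_setOf_blockLT (d b : ℕ) : {a | blockLT d a b}.Finite := by
  refine ((Set.finite_Iic (block d b)).biUnion fun m _ => finite_block_eq d m).subset
    fun a ha => Set.mem_biUnion (x := block d a) ?_ rfl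
  simp only [Set.mem_ofPred_eq, blockLT] at ha
  simp only [Set.mem_Iic]
  omega

/-- A strict linear order on an infinite type all of whose initial segments are finite is
isomorphic to `(ℕ, <)`. -/
theorem nonempty_relIso_nat_of_finite {α : Type*} [Infinite α] (r : α → α → Prop)
    [IsStrictTotalOrder α r] (hfin : ∀ b, {a | r a b}.Finite) :
    Nonempty (r ≃r ((· < ·) : ℕ → ℕ → Prop)) := by
  -- Counting predecessors embeds the order in `ℕ`; the range is infinite, hence itself isomorphic
  -- to `ℕ`.
  have hmono : ∀ a b, r a b → {c | r c a}.ncard < {c | r c b}.ncard := fun a b h =>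
    Set.ncard_lt_ncard
      ⟨fun c hc => _root_.trans (r := r) hc h, fun hs => irrefl_of r a (hs h)⟩ (hfin b)
  let f : r ↪r ((· < ·) : ℕ → ℕ → Prop) := RelEmbedding.ofMonotone _ hmono
  have : Infinite (Set.range f) := (Set.infinite_range_of_injective f.injective).to_subtype
  classical
  let g := Nat.Subtype.orderIsoOfNat (Set.range f)
  refine ⟨RelIso.trans (s := ((· < ·) : Set.range f → Set.range f → Prop))
    ⟨Equiv.ofInjective f f.injective, f.map_rel_iff⟩ g.symm.toRelIsoLT⟩

theorem isCopyOfOmega_blockOrder (d : ℕ) : (blockOrder d).IsCopyOfOmega := by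
  let L := blockOrder d
  have : Infinite L.domain := Set.infinite_univ.to_subtype
  have : IsStrictTotalOrder L.domain fun a b => L.lt a b :=
    { irrefl := fun a => L.irrefl a
      trans := fun a b c => L.trans a b c
      trichotomous := fun a b h h' =>
        Subtype.ext (((L.total a a.2 b b.2).resolve_left h).resolve_right h') }
  exact nonempty_relIso_nat_of_finite _ fun b =>
    (finite_setOf_blockLT d b).preimage Subtype.val_injective.injOn

/-! ### No immediate successor of `[id]` -/

/-- The number that separates `n` from the value of the code `e` at `n`, if this value exists. -/
def separator (d e n : ℕ) : Part ℕ :=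
  (Nat.rfind fun s => Part.some (decide (HaltsAfter e n s))).map
    fun s => 2 * Nat.pair (Nat.pair (n / 2) e) s + (1 - d)

theorem partrec_separator (d e : ℕ) : Partrec (separator d e) := by
  have h1 : Computable₂ fun n s : ℕ => decide (HaltsAfter e n s) :=
    (primrecPred_haltsAfter (α := ℕ × ℕ) (Primrec.const e) Primrec.fst
      Primrec.snd).decide.to_comp
  have h2 : Primrec₂ fun n s : ℕ => 2 * Nat.pair (Nat.pair (n / 2) e) s + (1 - d) :=
    Primrec.nat_add.comp
      (Primrec.nat_mul.comp (Primrec.const 2)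
        (Primrec₂.natPair.comp
          (Primrec₂.natPair.comp (Primrec.nat_div.comp Primrec.fst (Primrec.const 2))
            (Primrec.const e)) Primrec.snd)) (Primrec.const (1 - d))
  exact (Partrec.rfind h1.partrec₂).map h2.to_comp

theorem exists_mem_separator {d e n v : ℕ} (hd : d < 2) (hn : n % 2 = d) (hen : e < n / 2)
    (hv : v ∈ eval (Denumerable.ofNat Code e) n) (hlt : blockLT d n v) :
    ∃ z ∈ separator d e n, blockLT d n z ∧ blockLT d z v := by
  obtain ⟨s, hs⟩ := exists_haltsAfter hv
  have hmem : s ∈ Nat.rfind fun s => Part.some (decide (HaltsAfter e n s)) := by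
    refine Nat.mem_rfind.2 ⟨Part.mem_some_iff.2 (decide_eq_true hs).symm, fun {m} hm => ?_⟩
    exact Part.mem_some_iff.2 (decide_eq_false fun h => hm.ne (h.unique hs)).symm
  refine ⟨_, Part.mem_map _ hmem, ?_⟩
  set t := Nat.pair (Nat.pair (n / 2) e) s with ht
  have hvs := hs.value_le hv
  -- As `n / 2` is positive, these bounds give `v ≤ s < t`, so the separator is numerically above
  -- `v` and precedes it if `v` shares its block.
  have hts := Nat.add_le_pair (Nat.pair (n / 2) e) s
  have hne := Nat.add_le_pair (n / 2) e
  have hz2 : (2 * t + (1 - d)) / 2 = t := by omega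
  have hzd : (2 * t + (1 - d)) % 2 ≠ d := by omega
  have hreq : IsRequest d t := by
    have h2 : 2 * (n / 2) + d = n := by omega
    simp only [IsRequest, ht, Nat.unpair_pair, h2]
    exact ⟨hen, hs⟩
  have hzb : block d (2 * t + (1 - d)) = n / 2 := by
    rw [block, if_neg hzd, hz2, if_pos hreq, ht, Nat.unpair_pair, Nat.unpair_pair]
  have hnb : block d n = n / 2 := by simp [block, hn]
  unfold blockLT at hlt ⊢
  omega

/-- For a code of a representative of `b`, the separator function is partial computable and defined
almost everywhere on `C`, so its class lies strictly between `[id]` and `b`. -/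
theorem not_mk_id_covBy {C : Set ℕ} {d : ℕ} (hd : d < 2) (hC : AlmostSubset C {x | x % 2 = d})
    (hid : IsRepresentative (blockOrder d) C fun n => Part.some n)
    (b : CohesivePower (blockOrder d) C) :
    ¬ (CohesivePower.mk (fun n => Part.some n) hid ⋖ b) := by
  rintro ⟨hlt, hcov⟩
  induction b using Quotient.inductionOn with | _ φ
  obtain ⟨c, hc⟩ := Nat.Partrec.Code.exists_code.1 (Partrec.nat_iff.1 φ.2.1)
  have hlt' : AlmostSubset C
      {x | ∃ a b, a ∈ Part.some x ∧ b ∈ φ.1 x ∧ blockLT d a b} := hlt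
  have hlarge : AlmostSubset C {x | Encodable.encode c < x / 2} := by
    refine (Set.finite_Iio (2 * Encodable.encode c + 2)).subset fun x hx => ?_
    have := hx.2
    simp only [Set.mem_ofPred_eq, Set.mem_Iio] at this ⊢
    omega
  have hsep : AlmostSubset C {n | ∃ v ∈ φ.1 n, ∃ z ∈ separator d (Encodable.encode c) n,
      blockLT d n z ∧ blockLT d z v} := by
    refine ((hC.inter hlarge).inter hlt').mono ?_
    rintro n ⟨⟨hn, hen⟩, a, v, ha, hv, hav⟩
    obtain rfl := Part.mem_some_iff.1 ha
    exact ⟨v, hv, exists_mem_separator hd hn hen (by simpa [hc] using hv) hav⟩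
  have hrep : IsRepresentative (blockOrder d) C (separator d (Encodable.encode c)) :=
    ⟨partrec_separator _ _, fun _ _ _ => trivial,
      hsep.mono fun n ⟨_, _, _, hz, _⟩ => Part.dom_iff_mem.2 ⟨_, hz⟩⟩
  exact hcov (c := CohesivePower.mk _ hrep)
    (hsep.mono fun n ⟨_, _, z, hz, hnz, _⟩ => ⟨n, z, Part.mem_some n, hz, hnz⟩)
    (hsep.mono fun _ ⟨v, hv, z, hz, _, hzv⟩ => ⟨z, v, hz, hv, hzv⟩)

/-! ### Immediate successors in `ω + ζη`, and the distinguishing sentence -/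

theorem OmegaPlusZetaEta.exists_covBy (a : OmegaPlusZetaEta) : ∃ b, a ⋖ b := by
  induction a using Lex.rec with | _ a
  rcases a with n | p
  · refine ⟨toLex (.inl (n + 1)), Sum.Lex.inl_lt_inl_iff.2 n.lt_succ_self, fun c h1 h2 => ?_⟩
    induction c using Lex.rec with | _ c
    rcases c with m | q
    · have h1 := Sum.Lex.inl_lt_inl_iff.1 h1
      have h2 := Sum.Lex.inl_lt_inl_iff.1 h2
      omega
    · exact Sum.Lex.not_inr_lt_inl h2
  · induction p using Lex.rec with | _ p
    obtain ⟨q, k⟩ := p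
    refine ⟨toLex (.inr (toLex (q, k + 1))), Sum.Lex.inr_lt_inr_iff.2
      (Prod.Lex.toLex_lt_toLex.2 (.inr ⟨rfl, lt_add_one k⟩)), fun c h1 h2 => ?_⟩
    induction c using Lex.rec with | _ c
    rcases c with m | r
    · exact Sum.Lex.not_inr_lt_inl h1
    · induction r using Lex.rec with | _ r
      obtain ⟨q', k'⟩ := r
      have h1 := Prod.Lex.toLex_lt_toLex.1 (Sum.Lex.inr_lt_inr_iff.1 h1)
      have h2 := Prod.Lex.toLex_lt_toLex.1 (Sum.Lex.inr_lt_inr_iff.1 h2)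
      simp only at h1 h2
      rcases h1 with h1 | ⟨rfl, h1⟩ <;> rcases h2 with h2 | ⟨h2', h2⟩
      · exact lt_asymm h1 h2
      · exact h1.ne' h2'
      · exact lt_irrefl _ h2
      · omega

open FirstOrder FirstOrder.Language

/-- The atomic formula `t ≺ u`. -/
def ltFormula {α : Type} {n : ℕ} (t u : linOrd.Term (α ⊕ Fin n)) : linOrd.BoundedFormula α n :=
  Relations.boundedFormula₂ (LinOrdRel.lt : linOrd.Relations 2) t u

theorem realize_ltFormula {M : Type} [LT M] {α : Type} {n : ℕ} (t u : linOrd.Term (α ⊕ Fin n))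
    (v : α → M) (w : Fin n → M) :
    (ltFormula t u).Realize v w ↔ t.realize (Sum.elim v w) < u.realize (Sum.elim v w) :=
  BoundedFormula.realize_rel₂

/-- The sentence `∀ x, ∃ y, x ≺ y ∧ ∀ z, x ≺ z → ¬ z ≺ y`. -/
def existsCovBySentence : linOrd.Sentence :=
  ∀' ∃' (ltFormula (&0) (&1) ⊓ ∀' ((ltFormula (&0) (&2)).imp (∼(ltFormula (&2) (&1)))))

theorem realize_existsCovBySentence (M : Type) [LT M] :
    existsCovBySentence.Realize M ↔ ∀ a : M, ∃ b, a ⋖ b := by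
  simp [existsCovBySentence, Sentence.Realize, Formula.Realize, realize_ltFormula, CovBy,
    Fin.snoc]

end CohPow

open CohPow in
theorem mainTheorem6 (C : Set ℕ) (hC : CohPow.IsCohesive C) :
    ∃ L : CohPow.ComputableLinearOrder, L.IsCopyOfOmega ∧
      L.domain = Set.univ ∧
      ¬ CohPow.linOrd.ElementarilyEquivalent (CohPow.CohesivePower L C) CohPow.OmegaPlusZetaEta ∧
      IsEmpty (((· < ·) : CohPow.CohesivePower L C → CohPow.CohesivePower L C → Prop) ≃r
        ((· < ·) : CohPow.OmegaPlusZetaEta → CohPow.OmegaPlusZetaEta → Prop)) ∧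
      ∃ hid : CohPow.IsRepresentative L C (fun n => Part.some n),
        ∀ b : CohPow.CohesivePower L C,
          ¬ (CohPow.CohesivePower.mk (fun n => Part.some n) hid ⋖ b) := by
  obtain ⟨d, hd, hCd⟩ : ∃ d < 2, AlmostSubset C {x | x % 2 = d} := by
    rcases hC.2 {x | x % 2 = 0} (PrimrecPred.computablePred (primrecPred_mod_two 0)).to_re with
      h | h
    · exact ⟨0, by omega, h⟩
    · refine ⟨1, by omega, h.mono fun x hx => ?_⟩
      simp only [Set.mem_compl_iff, Set.mem_ofPred_eq] at hx ⊢
      omega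
  have hid : IsRepresentative (blockOrder d) C fun n => Part.some n := by
    refine ⟨Computable.id.partrec, fun _ _ _ => trivial, ?_⟩
    simp [AlmostSubset, PFun.Dom]
  have hcov := not_mk_id_covBy hd hCd hid
  refine ⟨blockOrder d, isCopyOfOmega_blockOrder d, rfl, fun h => ?_, ⟨fun f => ?_⟩, hid, hcov⟩
  · obtain ⟨b, hb⟩ := (realize_existsCovBySentence _).1
      ((FirstOrder.Language.elementarilyEquivalent_iff.1 h existsCovBySentence).2
        ((realize_existsCovBySentence _).2 OmegaPlusZetaEta.exists_covBy))
      (CohesivePower.mk _ hid)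
    exact hcov b hb
  · obtain ⟨b, hb, hb'⟩ := OmegaPlusZetaEta.exists_covBy (f (CohesivePower.mk _ hid))
    refine hcov (f.symm b) ⟨f.map_rel_iff.1 (by simpa using hb), fun c h1 h2 => ?_⟩
    exact hb' (f.map_rel_iff.2 h1) (by simpa using f.map_rel_iff.2 h2)
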